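/- Let $0<s<1$, $0<\lambda\le\Lambda$, and for $u:\mathbb{R}^n\to\mathbb{R}$ put $\delta u(x,y)=u(x+y)+u(x-y)-2u(x)$. Let $\mathcal{L}_0$ be the class of linear operators $Lv(x)=\int_{\mathbb{R}^n}\delta v(x,y)\,a(y)\,dy$ whose kernels are measurable, satisfy $a(-y)=a(y)$, and $$(1-s)\frac{\lambda}{|y|^{n+2s}}\le a(y)\le(1-s)\frac{\Lambda}{|y|^{n+2s}}\qquad (y\neq 0),$$ and let $M^-v(x)=\inf_{L\in\mathcal{L}_0}Lv(x)$, $M^+v(x)=\sup_{L\in\mathcal{L}_0}Lv(x)$. Say $v\in C^{1,1}(x)$ if $P\le v\le Q$ near $x$ for some quadratic polynomials $P,Q$ with $P(x)=v(x)=Q(x)$. Let $I$ be a nonlocal operator, i.e. $Iv(x)$ is defined for every bounded measurable $v\in C^{1,1}(x)$, and $Iv$ is continuous on every open set on which $v$ is $C^2$. Suppose that $I$ is uniformly elliptic with respect to $\mathcal{L}_0$, i.e. $M^-(v-w)(x)\le Iv(x)-Iw(x)\le M^+(v-w)(x)$ for all bounded measurable $v,w\in C^{1,1}(x)$; that $I$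 is translation invariant, i.e. $I(v(\cdot-z))(x)=(Iv)(x-z)$; and that $I(0)=0$. Let $U\subset\mathbb{R}^n$ be a bounded open set and $K\subset\mathbb{R}^n$ a compact convex set whose interior contains the origin. Let $\gamma(x)=\inf\{t>0:x\in tK\}$ be the gauge function of $K$, and $\gamma^\circ$ the gauge function of the polar $K^\circ=\{x:\langle x,y\rangle\le1\ \text{for all } y\in K\}$. Let $\varphi:\mathbb{R}^n\to\mathbb{R}$ be bounded, with $-\gamma(y-x)\le\varphi(x)-\varphi(y)\le\gamma(x-y)$ for all $x,y\in\mathbb{R}^n$, and convex on a neighborhood of $\partial U$ (that is, some open set containing $\partial U$ has the property that $\varphi$ is convex on each of its convex subsets). Define $$\rho(x)=\min_{y\in\partial U}[\gamma(x-y)+\varphi(y)],\qquad \bar\rho(x)=\min_{y\in\partial U}[\gamma(y-x)-\varphi(y)]\qquad(x\in U),$$ and $\rho=-\bar\rho=\varphi$ on $\mathbb{R}^n-U$. Let $u:\mathbb{R}^n\to\mathbb{R}$ be a continuous function which is $C^1$ in $U$ and is a viscosity solution of the double obstacle problem $$\begin{cases}\max\{\min\{-Iu,\;u+\bar\rho\},\,u-\rho\}=0&\text{in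 }U,\\ u=\varphi&\text{in }\mathbb{R}^n-U,\end{cases}$$ where the first line means: for every bounded $\psi\in C^2(\mathbb{R}^n)$ and every $x_0\in U$, the number $\max\{\min\{-I\psi(x_0),\,u(x_0)+\bar\rho(x_0)\},\,u(x_0)-\rho(x_0)\}$ is $\le0$ if $u-\psi$ has a maximum over $\mathbb{R}^n$ at $x_0$, and is $\ge0$ if $u-\psi$ has a minimum over $\mathbb{R}^n$ at $x_0$. Then $\gamma^\circ(Du(x))\le1$ for every $x\in U$. Moreover, $u$ is Lipschitz continuous on $\overline U$. -/

import Mathlib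

open Set MeasureTheory
open scoped NNReal Gradient

noncomputable section

/-- The Euclidean space `ℝⁿ`. -/
abbrev RSpace (n : ℕ) : Type := EuclideanSpace ℝ (Fin n)

/-! ### Nonlocal operators -/

/-- The second order difference `δu(x,y) = u(x+y) + u(x-y) - 2u(x)`. -/
def secondDiff {n : ℕ} (u : RSpace n → ℝ) (x y : RSpace n) : ℝ :=
  u (x + y) + u (x - y) - 2 * u x

/-- The kernels of linear nonlocal operators: positive (measurable) functions, symmetric, with
`∫ min{1,|y|²} a(y) dy < ∞`. The value at the origin is irrelevant. -/
structure IsNonlocalKernel {n : ℕ} (a : RSpace n → ℝ) : Prop where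
  measurable : Measurable a
  pos : ∀ y, y ≠ 0 → 0 < a y
  symm : ∀ y, a (-y) = a y
  integrable : Integrable (fun y => min 1 (‖y‖ ^ 2) * a y) volume

/-- The linear nonlocal operator `Lu(x) = ∫ δu(x,y) a(y) dy` with kernel `a`. -/
def linearOp {n : ℕ} (a : RSpace n → ℝ) (u : RSpace n → ℝ) (x : RSpace n) : ℝ :=
  ∫ y, secondDiff u x y * a y

/-- The extremal operator `M⁻u(x) = inf_L Lu(x)` over a family of linear operators, given by the
set of their kernels. -/
def extremalInf {n : ℕ} (𝓛 : Set (RSpace n → ℝ)) (u : RSpace n → ℝ) (x : RSpace n) : ℝ :=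
  sInf ((fun a => linearOp a u x) '' 𝓛)

/-- The extremal operator `M⁺u(x) = sup_L Lu(x)` over a family of linear operators, given by the
set of their kernels. -/
def extremalSup {n : ℕ} (𝓛 : Set (RSpace n → ℝ)) (u : RSpace n → ℝ) (x : RSpace n) : ℝ :=
  sSup ((fun a => linearOp a u x) '' 𝓛)

/-- The class `𝓛₀`: kernels with
`(1-s) lam / |y|^(n+2s) ≤ a(y) ≤ (1-s) Lam / |y|^(n+2s)`. -/
def kernelClassL0 (n : ℕ) (s lam Lam : ℝ) : Set (RSpace n → ℝ) :=
  {a | IsNonlocalKernel a ∧ ∀ y, y ≠ 0 →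
    (1 - s) * (lam / ‖y‖ ^ ((n : ℝ) + 2 * s)) ≤ a y ∧
      a y ≤ (1 - s) * (Lam / ‖y‖ ^ ((n : ℝ) + 2 * s))}

/-- Polynomial functions of degree at most two on `ℝⁿ`. -/
def IsQuadraticPoly {n : ℕ} (P : RSpace n → ℝ) : Prop :=
  ∃ (c : ℝ) (ℓ : RSpace n →L[ℝ] ℝ) (B : RSpace n →L[ℝ] RSpace n →L[ℝ] ℝ),
    ∀ z, P z = c + ℓ z + B z z

/-- `u ∈ C^{1,1}(x)`: near `x`, the function `u` lies between two quadratic polynomials which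
agree with `u` at `x`. -/
def IsC11At {n : ℕ} (u : RSpace n → ℝ) (x : RSpace n) : Prop :=
  ∃ P Q : RSpace n → ℝ, IsQuadraticPoly P ∧ IsQuadraticPoly Q ∧ P x = u x ∧ Q x = u x ∧
    ∀ᶠ z in nhds x, P z ≤ u z ∧ u z ≤ Q z

/-- `u` is a bounded function on `ℝⁿ`. -/
def IsBddFun {n : ℕ} (u : RSpace n → ℝ) : Prop := ∃ C : ℝ, ∀ x, |u x| ≤ C

/-- The functions to which a nonlocal operator can be applied at `x`: bounded (measurable)
functions in `C^{1,1}(x)`. -/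
structure Admissible {n : ℕ} (u : RSpace n → ℝ) (x : RSpace n) : Prop where
  measurable : Measurable u
  bounded : IsBddFun u
  c11 : IsC11At u x

/-- A nonlocal operator. The value `I u x` is meaningful for `u` admissible at `x` (other values
are never constrained or used), and `I u` is continuous on every open set over which
`u` is `C²`. -/
def IsNonlocalOperator {n : ℕ} (I : (RSpace n → ℝ) → RSpace n → ℝ) : Prop :=
  ∀ (u : RSpace n → ℝ) (O : Set (RSpace n)), Measurable u → IsBddFun u → IsOpen O →
    ContDiffOn ℝ 2 u O → ContinuousOn (I u) O

/-- Uniform ellipticity with respect to a family of linear operators: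
`M⁻(u-v)(x) ≤ Iu(x) - Iv(x) ≤ M⁺(u-v)(x)`. -/
def IsUniformlyElliptic {n : ℕ} (𝓛 : Set (RSpace n → ℝ))
    (I : (RSpace n → ℝ) → RSpace n → ℝ) : Prop :=
  ∀ (u v : RSpace n → ℝ) (x : RSpace n), Admissible u x → Admissible v x →
    extremalInf 𝓛 (u - v) x ≤ I u x - I v x ∧ I u x - I v x ≤ extremalSup 𝓛 (u - v) x

/-- Translation invariance: `I(τ_z u) = τ_z(Iu)`, where `τ_z u(x) = u(x-z)`. -/
def IsTranslationInvariant {n : ℕ} (I : (RSpace n → ℝ) → RSpace n → ℝ) : Prop :=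
  ∀ (u : RSpace n → ℝ) (z x : RSpace n), Admissible u (x - z) →
    I (fun y => u (y - z)) x = I u (x - z)

/-! ### Polar sets and obstacles. The gauge function of `K` is Mathlib's `gauge K`. -/

/-- The (one-sided) polar `K° = {x : ⟨x,y⟩ ≤ 1 for all y ∈ K}`. -/
def polarSet {n : ℕ} (K : Set (RSpace n)) : Set (RSpace n) :=
  {x | ∀ y ∈ K, inner ℝ x y ≤ 1}

open Classical in
/-- `ρ(x) = min_{y ∈ ∂U} [γ(x-y) + φ(y)]` in `U`, and `ρ = φ` outside `U`. -/
def rho {n : ℕ} (K U : Set (RSpace n)) (φ : RSpace n → ℝ) (x : RSpace n) : ℝ :=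
  if x ∈ U then sInf ((fun y => gauge K (x - y) + φ y) '' frontier U) else φ x

open Classical in
/-- `ρ̄(x) = min_{y ∈ ∂U} [γ(y-x) - φ(y)]` in `U`, and `-ρ̄ = φ` outside `U`. -/
def rhoBar {n : ℕ} (K U : Set (RSpace n)) (φ : RSpace n → ℝ) (x : RSpace n) : ℝ :=
  if x ∈ U then sInf ((fun y => gauge K (y - x) - φ y) '' frontier U) else -φ x

/-- `φ` is convex on a neighborhood of the set `S` (which need not be convex): there is an open
set containing `S` such that `φ` is convex on each of its convex subsets. -/
def ConvexNear {n : ℕ} (φ : RSpace n → ℝ) (S : Set (RSpace n)) : Prop :=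
  ∃ N : Set (RSpace n), IsOpen N ∧ S ⊆ N ∧ ∀ C ⊆ N, Convex ℝ C → ConvexOn ℝ C φ

/-! ### Viscosity solutions. Below `F x r p v` stands for `-Ĩ(x, r, p, v(·))`, where `r` is the
place of `u(x)`, `p` that of the gradient, and `v` that of the whole function. -/

/-- Viscosity subsolution of `F ≤ 0` in `U`. -/
def IsViscositySubsolution {n : ℕ}
    (F : RSpace n → ℝ → RSpace n → (RSpace n → ℝ) → ℝ)
    (U : Set (RSpace n)) (u : RSpace n → ℝ) : Prop :=
  UpperSemicontinuous u ∧
    ∀ (ψ : RSpace n → ℝ) (x₀ : RSpace n), IsBddFun ψ → ContDiff ℝ 2 ψ → x₀ ∈ U →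
      (∀ x, u x - ψ x ≤ u x₀ - ψ x₀) → F x₀ (u x₀) (∇ ψ x₀) ψ ≤ 0

/-- Viscosity supersolution of `F ≥ 0` in `U`. -/
def IsViscositySupersolution {n : ℕ}
    (F : RSpace n → ℝ → RSpace n → (RSpace n → ℝ) → ℝ)
    (U : Set (RSpace n)) (u : RSpace n → ℝ) : Prop :=
  LowerSemicontinuous u ∧
    ∀ (ψ : RSpace n → ℝ) (x₀ : RSpace n), IsBddFun ψ → ContDiff ℝ 2 ψ → x₀ ∈ U →
      (∀ x, u x₀ - ψ x₀ ≤ u x - ψ x) → 0 ≤ F x₀ (u x₀) (∇ ψ x₀) ψ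

/-- Viscosity solution of `F = 0` in `U`. -/
def IsViscositySolution {n : ℕ}
    (F : RSpace n → ℝ → RSpace n → (RSpace n → ℝ) → ℝ)
    (U : Set (RSpace n)) (u : RSpace n → ℝ) : Prop :=
  Continuous u ∧ IsViscositySubsolution F U u ∧ IsViscositySupersolution F U u

/-- The expression `max{min{-Iv(x), r + ρ̄(x)}, r - ρ(x)}` of the double obstacle problem. -/
def doubleObstacleExpr {n : ℕ} (I : (RSpace n → ℝ) → RSpace n → ℝ) (K U : Set (RSpace n))
    (φ : RSpace n → ℝ) (x : RSpace n) (r : ℝ) (_p : RSpace n) (v : RSpace n → ℝ) : ℝ :=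
  max (min (-(I v x)) (r + rhoBar K U φ x)) (r - rho K U φ x)

/-- `u` is a viscosity solution of the double obstacle problem
`max{min{-Iu, u + ρ̄}, u - ρ} = 0` in `U`, `u = φ` in `ℝⁿ - U`. -/
def SolvesDoubleObstacle {n : ℕ} (I : (RSpace n → ℝ) → RSpace n → ℝ) (K U : Set (RSpace n))
    (φ u : RSpace n → ℝ) : Prop :=
  IsViscositySolution (doubleObstacleExpr I K U φ) U u ∧ ∀ x, x ∉ U → u x = φ x

end

/-! ### The fractional kernel -/

/-! Both conclusions follow from the global bound `u x - u y ≤ gauge K (x - y)`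
(`SolvesDoubleObstacle.sub_le_gauge`): differentiating it along directions in `K` puts the gradient
in the polar, and the gauge is itself Lipschitz.

The bound is proved by doubling variables. If it fails by `m > 0`, replace the gauge by a smooth `θ`
within `m / 4` of it and maximize `u x - u y - θ (x - y)`. The maximum is attained at some `(x₀,
y₀)`, where `u x₀ - u y₀` still exceeds the gauge by `m / 2`. Both obstacles obey the same one-sided
Lipschitz bound, also across `∂U`. Hence both points lie in `U`, `u` is strictly above `-ρ̄` at
`x₀`, and `u` is strictly below `ρ` at `y₀`. There the equation leaves `Iu ≥ 0` at `x₀` and `Iu ≤ 0`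
at `y₀`, in the viscosity sense.

These two inequalities are incompatible (`doubled_max_comparison`). Moving both points by the same
vector leaves `θ (x - y)` unchanged, so `u (x₀ + y) - u (y₀ + y)` is largest at `y = 0`. For large
`y` both points leave `U`, and the Lipschitz bound on `φ` makes this difference smaller by at least
`m / 2`. That far deficit makes `M⁺` of the difference of the test functions strictly negative
(`exists_extremalSup_neg`), while ellipticity and translation invariance would make it nonnegative.
-/

theorem fracKernel_nonneg {n : ℕ} (s : ℝ) (y : RSpace n) :
    0 ≤ (‖y‖ ^ ((n : ℝ) + 2 * s))⁻¹ := by positivity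

theorem integrable_min_one_sq_mul_fracKernel {n : ℕ} [NeZero n] {s : ℝ} (hs0 : 0 < s) (hs1 : s < 1) :
    Integrable (fun y : RSpace n => min 1 (‖y‖ ^ 2) * (‖y‖ ^ ((n : ℝ) + 2 * s))⁻¹) := by
  rw [integrable_fun_norm_addHaar (E := RSpace n) volume
    (f := fun r : ℝ => min 1 (r ^ 2) * (r ^ ((n : ℝ) + 2 * s))⁻¹)]
  have hn : 1 ≤ n := Nat.one_le_iff_ne_zero.2 (NeZero.ne n)
  -- In polar coordinates the kernel has radial density `r ^ (-1 - 2 * s)`. With the weight, `s < 1`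
  -- gives integrability at `0` and `0 < s` at infinity.
  have key : ∀ r : ℝ, 0 < r → r ^ (Module.finrank ℝ (RSpace n) - 1) *
      (r ^ ((n : ℝ) + 2 * s))⁻¹ = r ^ (-1 - 2 * s) := by
    intro r hr
    rw [finrank_euclideanSpace_fin, ← Real.rpow_natCast, ← Real.rpow_neg hr.le,
      ← Real.rpow_add hr]
    congr 1
    push_cast [hn]
    ring
  rw [← Ioc_union_Ioi_eq_Ioi zero_le_one, integrableOn_union]
  constructor
  · have h1 : IntegrableOn (fun r : ℝ => r ^ (1 - 2 * s)) (Ioc 0 1) :=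
      (intervalIntegrable_iff_integrableOn_Ioc_of_le zero_le_one).1
        (intervalIntegral.intervalIntegrable_rpow' (by linarith))
    refine h1.congr_fun (fun r hr => ?_) measurableSet_Ioc
    have hr0 : 0 < r := hr.1
    have : r ^ (1 - 2 * s) = r ^ 2 * r ^ (-1 - 2 * s) := by
      rw [← Real.rpow_natCast, ← Real.rpow_add hr0]
      congr 1
      push_cast
      ring
    simp only [smul_eq_mul]
    rw [this, ← key r hr0, min_eq_right (pow_le_one₀ hr0.le hr.2)]
    ring
  · have h1 : IntegrableOn (fun r : ℝ => r ^ (-1 - 2 * s)) (Ioi 1) :=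
      integrableOn_Ioi_rpow_of_lt (by linarith) zero_lt_one
    refine h1.congr_fun (fun r hr => ?_) measurableSet_Ioi
    have hr1 : 1 < r := hr
    simp only [smul_eq_mul]
    rw [← key r (by linarith), min_eq_left (one_le_pow₀ hr1.le)]
    ring

theorem kernelClassL0_nonempty {n : ℕ} [NeZero n] {s lam Lam : ℝ} (hs0 : 0 < s) (hs1 : s < 1)
    (hlam : 0 < lam) (hLam : lam ≤ Lam) : (kernelClassL0 n s lam Lam).Nonempty := by
  refine ⟨fun y => (1 - s) * (lam / ‖y‖ ^ ((n : ℝ) + 2 * s)), ⟨?_, ?_, ?_, ?_⟩, ?_⟩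
  · fun_prop
  · intro y hy
    have := norm_pos_iff.2 hy
    have : 0 < 1 - s := by linarith
    positivity
  · intro y
    simp
  · refine ((integrable_min_one_sq_mul_fracKernel (n := n) hs0 hs1).const_mul
      ((1 - s) * lam)).congr (Filter.Eventually.of_forall fun y => ?_)
    simp only [div_eq_mul_inv]
    ring
  · intro y hy
    refine ⟨le_rfl, ?_⟩
    have : 0 ≤ 1 - s := by linarith
    show (1 - s) * (lam / _) ≤ _
    gcongr

theorem integrableOn_fracKernel {n : ℕ} [NeZero n] {s : ℝ} (hs0 : 0 < s) (hs1 : s < 1)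
    {r : ℝ} (hr : 0 < r) :
    IntegrableOn (fun y : RSpace n => (‖y‖ ^ ((n : ℝ) + 2 * s))⁻¹) {y | r ≤ ‖y‖} := by
  have h := ((integrable_min_one_sq_mul_fracKernel (n := n) hs0 hs1).const_mul
    (min 1 (r ^ 2))⁻¹).integrableOn (s := {y | r ≤ ‖y‖})
  have hm : 0 < min 1 (r ^ 2) := by positivity
  refine Integrable.mono' h (Measurable.aestronglyMeasurable (by fun_prop)) ?_
  refine (ae_restrict_iff' (measurableSet_le measurable_const measurable_norm)).2
    (Filter.Eventually.of_forall fun y hy => ?_)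
  rw [Real.norm_of_nonneg (fracKernel_nonneg s y), ← mul_assoc]
  refine le_mul_of_one_le_left (fracKernel_nonneg s y) ?_
  rw [inv_mul_eq_div, one_le_div hm]
  have : r ≤ ‖y‖ := hy
  gcongr

theorem integrableOn_sq_mul_fracKernel {n : ℕ} [NeZero n] {s : ℝ} (hs0 : 0 < s) (hs1 : s < 1) :
    IntegrableOn (fun y : RSpace n => ‖y‖ ^ 2 * (‖y‖ ^ ((n : ℝ) + 2 * s))⁻¹)
      (Metric.ball 0 1) := by
  refine (integrable_min_one_sq_mul_fracKernel (n := n) hs0 hs1).integrableOn.congr_fun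
    (fun y hy => ?_) measurableSet_ball
  have hy1 : ‖y‖ < 1 := by simpa using hy
  simp only [min_eq_right (pow_le_one₀ (norm_nonneg y) hy1.le)]

theorem exists_setIntegral_ball_sq_mul_fracKernel_lt {n : ℕ} [NeZero n] {s : ℝ} (hs0 : 0 < s)
    (hs1 : s < 1) {η : ℝ} (hη : 0 < η) {r₀ : ℝ} (hr₀ : 0 < r₀) :
    ∃ r, 0 < r ∧ r < r₀ ∧ r ≤ 1 ∧
      ∫ y in Metric.ball (0 : RSpace n) r, ‖y‖ ^ 2 * (‖y‖ ^ ((n : ℝ) + 2 * s))⁻¹ < η := by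
  have hlim := tendsto_setIntegral_of_antitone (μ := (volume : Measure (RSpace n)))
    (f := fun y : RSpace n => ‖y‖ ^ 2 * (‖y‖ ^ ((n : ℝ) + 2 * s))⁻¹)
    (s := fun m : ℕ => Metric.ball (0 : RSpace n) (1 / ((m : ℝ) + 1)))
    (fun _ => measurableSet_ball)
    (fun i j hij => Metric.ball_subset_ball (Nat.one_div_le_one_div hij))
    ⟨0, by simpa using integrableOn_sq_mul_fracKernel hs0 hs1⟩
  have hinter : (⋂ m : ℕ, Metric.ball (0 : RSpace n) (1 / ((m : ℝ) + 1))) ⊆ {0} := by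
    intro y hy
    by_contra hne
    obtain ⟨m, hm⟩ := exists_nat_one_div_lt (norm_pos_iff.2 hne)
    have := mem_iInter.1 hy m
    simp only [mem_ball_zero_iff] at this
    linarith
  have hzero : ∫ y in ⋂ m : ℕ, Metric.ball (0 : RSpace n) (1 / ((m : ℝ) + 1)),
      ‖y‖ ^ 2 * (‖y‖ ^ ((n : ℝ) + 2 * s))⁻¹ = 0 :=
    setIntegral_eq_zero_of_forall_eq_zero fun y hy => by simp [mem_singleton_iff.1 (hinter hy)]
  rw [hzero] at hlim
  obtain ⟨m, hm1, hm2⟩ := ((hlim.eventually_lt_const hη).and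
    (tendsto_one_div_add_atTop_nhds_zero_nat.eventually_lt_const hr₀)).exists
  refine ⟨1 / ((m : ℝ) + 1), by positivity, hm2, ?_, hm1⟩
  rw [div_le_one (by positivity)]
  linarith [(Nat.cast_nonneg m : (0 : ℝ) ≤ m)]

theorem setIntegral_fracKernel_pos {n : ℕ} [NeZero n] {s : ℝ} (hs0 : 0 < s) (hs1 : s < 1)
    {R : ℝ} (hR : 0 < R) :
    0 < ∫ y in {y : RSpace n | R ≤ ‖y‖}, (‖y‖ ^ ((n : ℝ) + 2 * s))⁻¹ := by
  refine (setIntegral_pos_iff_support_of_nonneg_ae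
    (Filter.Eventually.of_forall fun y => fracKernel_nonneg s y)
    (integrableOn_fracKernel hs0 hs1 hR)).2 ?_
  obtain ⟨y, hy⟩ := NormedSpace.exists_lt_norm ℝ (RSpace n) R
  have hopen : IsOpen {y : RSpace n | R < ‖y‖} := isOpen_lt continuous_const continuous_norm
  refine (hopen.measure_pos volume ⟨y, hy⟩).trans_le (measure_mono fun z hz => ?_)
  have hz' : R < ‖z‖ := hz
  have : 0 < ‖z‖ := hR.trans hz'
  exact ⟨by simp only [Function.mem_support]; positivity, hz'.le⟩

/-! ### Taylor expansion and admissibility -/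

/-- The derivative is `C¹`, hence Lipschitz near `x`, so on the ball of radius `‖y‖` it varies by at
most `C * ‖y‖`; the mean value inequality supplies the second factor. -/
theorem ContDiffAt.exists_taylor_bound {E : Type*} [NormedAddCommGroup E] [NormedSpace ℝ E]
    {f : E → ℝ} {x : E} (hf : ContDiffAt ℝ 2 f x) :
    ∃ C ≥ 0, ∃ r > 0, ∀ y, ‖y‖ < r → |f (x + y) - f x - fderiv ℝ f x y| ≤ C * ‖y‖ ^ 2 := by
  have hf' : ContDiffAt ℝ 1 (fderiv ℝ f) x := hf.fderiv_right (by norm_num)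
  obtain ⟨C, t, ht, hC⟩ := hf'.exists_lipschitzOnWith
  have hd : ∀ᶠ z in nhds x, DifferentiableAt ℝ f z :=
    (hf.eventually (by simp)).mono fun z hz => hz.differentiableAt (by simp)
  obtain ⟨r, hr, hball⟩ := Metric.mem_nhds_iff.1 (Filter.inter_mem ht hd)
  refine ⟨C, C.2, r, hr, fun y hy => ?_⟩
  have hsub : Metric.closedBall x ‖y‖ ⊆ t ∩ {z | DifferentiableAt ℝ f z} :=
    (Metric.closedBall_subset_ball hy).trans hball
  have hx : x ∈ Metric.closedBall x ‖y‖ := Metric.mem_closedBall_self (norm_nonneg y)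
  have := (convex_closedBall x ‖y‖).norm_image_sub_le_of_norm_fderiv_le' (𝕜 := ℝ) (f := f)
    (φ := fderiv ℝ f x) (C := C * ‖y‖) (fun z hz => (hsub hz).2)
    (fun z hz => (hC.norm_sub_le (hsub hz).1 (hsub hx).1).trans
      (by gcongr; simpa [dist_eq_norm] using hz))
    hx (y := x + y) (by simp)
  simpa [sq, mul_assoc] using this

theorem ContDiffAt.isC11At {n : ℕ} {f : RSpace n → ℝ} {x : RSpace n} (hf : ContDiffAt ℝ 2 f x) :
    IsC11At f x := by
  obtain ⟨C, -, r, hr, h⟩ := hf.exists_taylor_bound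
  have quad : ∀ D : ℝ, IsQuadraticPoly
      (fun z => f x + fderiv ℝ f x (z - x) + D * ‖z - x‖ ^ 2) := by
    intro D
    refine ⟨f x - fderiv ℝ f x x + D * ‖x‖ ^ 2,
      fderiv ℝ f x - (2 * D) • innerSL ℝ x, (D • innerSL ℝ : RSpace n →L[ℝ] RSpace n →L[ℝ] ℝ), fun z => ?_⟩
    simp only [map_sub, sub_apply, smul_apply, innerSL_apply_apply, smul_eq_mul,
      norm_sub_sq_real, real_inner_comm z x]
    rw [innerSL_apply_apply, real_inner_self_eq_norm_sq]
    ring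
  refine ⟨_, _, quad (-C), quad C, by simp, by simp, ?_⟩
  filter_upwards [Metric.ball_mem_nhds x hr] with z hz
  have := abs_le.1 (h (z - x) (by simpa [dist_eq_norm] using hz))
  rw [add_sub_cancel] at this
  constructor <;> linarith [this.1, this.2]

theorem ContDiff.admissible {n : ℕ} {f : RSpace n → ℝ} (hf : ContDiff ℝ 2 f) (hb : IsBddFun f)
    (x : RSpace n) : Admissible f x :=
  ⟨hf.continuous.measurable, hb, hf.contDiffAt.isC11At⟩

theorem ContDiffAt.exists_secondDiff_bound {n : ℕ} {f : RSpace n → ℝ} {x : RSpace n}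
    (hf : ContDiffAt ℝ 2 f x) :
    ∃ C ≥ 0, ∃ r > 0, ∀ y, ‖y‖ < r → |secondDiff f x y| ≤ C * ‖y‖ ^ 2 := by
  obtain ⟨C, hC, r, hr, h⟩ := hf.exists_taylor_bound
  refine ⟨2 * C, by positivity, r, hr, fun y hy => ?_⟩
  have h1 := abs_le.1 (h y hy)
  have h2 := abs_le.1 (h (-y) (by simpa using hy))
  simp only [map_neg, norm_neg, ← sub_eq_add_neg] at h2
  rw [secondDiff, abs_le]
  constructor <;> linarith [h1.1, h1.2, h2.1, h2.2]

theorem exists_secondDiff_bound_min {n : ℕ} {f : RSpace n → ℝ} {x : RSpace n}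
    (hf : ContDiffAt ℝ 2 f x) (hb : IsBddFun f) :
    ∃ C ≥ 0, ∀ y, |secondDiff f x y| ≤ C * min 1 (‖y‖ ^ 2) := by
  obtain ⟨C, hC, r, hr, h⟩ := hf.exists_secondDiff_bound
  obtain ⟨M, hM⟩ := hb
  have hM0 : 0 ≤ M := (abs_nonneg _).trans (hM 0)
  have hbd : ∀ y, |secondDiff f x y| ≤ 4 * M := fun y => by
    have h1 := abs_le.1 (hM (x + y))
    have h2 := abs_le.1 (hM (x - y))
    have h3 := abs_le.1 (hM x)
    rw [secondDiff, abs_le]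
    constructor <;> linarith [h1.1, h1.2, h2.1, h2.2, h3.1, h3.2]
  have hm : 0 < min 1 (r ^ 2) := by positivity
  refine ⟨C + 4 * M / min 1 (r ^ 2), by positivity, fun y => ?_⟩
  rcases le_or_gt r ‖y‖ with hy | hy
  · calc |secondDiff f x y| ≤ 4 * M := hbd y
      _ = 4 * M / min 1 (r ^ 2) * min 1 (r ^ 2) := by field_simp
      _ ≤ 4 * M / min 1 (r ^ 2) * min 1 (‖y‖ ^ 2) := by gcongr
      _ ≤ _ := by
        gcongr
        linarith
  · rcases le_total 1 (‖y‖ ^ 2) with h1 | h1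
    · rw [min_eq_left h1]
      have : 4 * M ≤ 4 * M / min 1 (r ^ 2) := by
        rw [le_div_iff₀ hm]
        exact mul_le_of_le_one_right (by positivity) (min_le_left _ _)
      linarith [hbd y]
    · rw [min_eq_right h1]
      refine (h y hy).trans ?_
      gcongr
      have : 0 ≤ 4 * M / min 1 (r ^ 2) := by positivity
      linarith

/-! ### A sufficient condition for the negativity of the maximal operator -/

/-- The upper kernel bound controls the two positive terms and the lower one the negative term,
uniformly over the class. The radius and `ε` precede `w` because the test functions are built from
them. -/
theorem exists_extremalSup_neg {n : ℕ} [NeZero n] {s lam Lam : ℝ} (hs0 : 0 < s) (hs1 : s < 1)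
    (hlam : 0 < lam) (hLam : lam ≤ Lam) {C c R r₀ : ℝ} (hC : 0 ≤ C) (hc : 0 < c) (hR : 0 < R)
    (hr₀ : 0 < r₀) :
    ∃ r, 0 < r ∧ r < r₀ ∧ ∃ ε > 0, ∀ (w : RSpace n → ℝ) (x : RSpace n), ContDiff ℝ 2 w →
      IsBddFun w →
      (∀ y, secondDiff w x y ≤ (Metric.ball 0 r).indicator (fun y => C * ‖y‖ ^ 2) y +
        {y | r / 2 ≤ ‖y‖}.indicator (fun _ => ε) y -
        {y | R ≤ ‖y‖}.indicator (fun _ => c) y) →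
      extremalSup (kernelClassL0 n s lam Lam) w x < 0 := by
  set k : RSpace n → ℝ := fun y => (‖y‖ ^ ((n : ℝ) + 2 * s))⁻¹ with hk
  have hk0 : ∀ y, 0 ≤ k y := fracKernel_nonneg s
  have hLam0 : 0 < Lam := hlam.trans_le hLam
  set A := ∫ y in {y : RSpace n | R ≤ ‖y‖}, k y with hA
  have hA0 : 0 < A := setIntegral_fracKernel_pos hs0 hs1 hR
  -- The far term contributes `-c * lam * A`. The radius is chosen first, so that the ball costs at
  -- most half of this; then `ε`, since `B` depends on `r`, to cost at most a quarter. Each `+ 1`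
  -- only keeps a denominator positive.
  have hη : 0 < c * lam * A / (2 * (C * Lam + 1)) := by positivity
  obtain ⟨r, hr, hrr₀, hr1, hJ⟩ :=
    exists_setIntegral_ball_sq_mul_fracKernel_lt (n := n) hs0 hs1 hη hr₀
  set J := ∫ y in Metric.ball (0 : RSpace n) r, ‖y‖ ^ 2 * k y with hJdef
  set B := ∫ y in {y : RSpace n | r / 2 ≤ ‖y‖}, k y with hB
  have hB0 : 0 ≤ B := integral_nonneg hk0
  have hJ0 : 0 ≤ J := integral_nonneg fun y => by positivity [hk0 y]
  have hε : 0 < c * lam * A / (4 * (Lam * B + 1)) := by positivity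
  set ε := c * lam * A / (4 * (Lam * B + 1)) with hεdef
  refine ⟨r, hr, hrr₀, ε, hε, fun w x hw hwb hbound => ?_⟩
  have hsm : ∀ t : ℝ, MeasurableSet {y : RSpace n | t ≤ ‖y‖} := fun t =>
    measurableSet_le measurable_const measurable_norm
  have i1 : Integrable ((Metric.ball (0 : RSpace n) r).indicator fun y => ‖y‖ ^ 2 * k y) :=
    (integrable_indicator_iff measurableSet_ball).2
      ((integrableOn_sq_mul_fracKernel hs0 hs1).mono_set (Metric.ball_subset_ball hr1))
  have i2 : Integrable ({y : RSpace n | r / 2 ≤ ‖y‖}.indicator k) :=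
    (integrable_indicator_iff (hsm _)).2 (integrableOn_fracKernel hs0 hs1 (by positivity))
  have i3 : Integrable ({y : RSpace n | R ≤ ‖y‖}.indicator k) :=
    (integrable_indicator_iff (hsm _)).2 (integrableOn_fracKernel hs0 hs1 hR)
  set h : RSpace n → ℝ := fun y =>
    (C * Lam) * (Metric.ball (0 : RSpace n) r).indicator (fun y => ‖y‖ ^ 2 * k y) y +
      (ε * Lam) * {y : RSpace n | r / 2 ≤ ‖y‖}.indicator k y -
      (c * lam) * {y : RSpace n | R ≤ ‖y‖}.indicator k y with hh
  have ih : Integrable h := ((i1.const_mul _).add (i2.const_mul _)).sub (i3.const_mul _)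
  have hval : ∫ y, h y = C * Lam * J + ε * Lam * B - c * lam * A := by
    refine (integral_sub ((i1.const_mul _).add (i2.const_mul _)) (i3.const_mul _)).trans ?_
    rw [integral_add' (i1.const_mul _) (i2.const_mul _), integral_const_mul, integral_const_mul,
      integral_const_mul, integral_indicator measurableSet_ball, integral_indicator (hsm _),
      integral_indicator (hsm _)]
  have hneg : ∫ y, h y < 0 := by
    have e1 : C * Lam * J ≤ c * lam * A / 2 := by
      have := hJ.le
      rw [le_div_iff₀ (by positivity)] at this
      nlinarith
    have e2 : ε * Lam * B ≤ c * lam * A / 4 := by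
      have : ε * (4 * (Lam * B + 1)) = c * lam * A := by rw [hεdef]; field_simp
      nlinarith
    rw [hval]
    have : 0 < c * lam * A := by positivity
    linarith
  have h1s : 0 < 1 - s := by linarith
  refine lt_of_le_of_lt (csSup_le ((kernelClassL0_nonempty hs0 hs1 hlam hLam).image _) ?_)
    (mul_neg_of_pos_of_neg h1s hneg)
  rintro _ ⟨a, ⟨ha, hab⟩, rfl⟩
  simp only [linearOp]
  rw [← integral_const_mul]
  have ia : Integrable (fun y => secondDiff w x y * a y) := by
    obtain ⟨D, -, hD⟩ := exists_secondDiff_bound_min hw.contDiffAt hwb (x := x)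
    refine (ha.integrable.const_mul D).mono' ?_ ?_
    · refine Measurable.aestronglyMeasurable (Measurable.mul ?_ ha.measurable)
      have := hw.continuous
      unfold secondDiff
      exact Continuous.measurable (by fun_prop)
    · filter_upwards [Measure.ae_ne volume (0 : RSpace n)] with y hy
      rw [norm_mul, Real.norm_eq_abs, Real.norm_of_nonneg (ha.pos y hy).le, ← mul_assoc]
      exact mul_le_mul_of_nonneg_right (hD y) (ha.pos y hy).le
  refine integral_mono_ae ia (ih.const_mul _) ?_
  filter_upwards [Measure.ae_ne volume (0 : RSpace n)] with y hy
  obtain ⟨hal, hau⟩ := hab y hy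
  have ha0 : 0 ≤ a y := (ha.pos y hy).le
  rw [div_eq_mul_inv] at hal hau
  change (1 - s) * (lam * k y) ≤ a y at hal
  change a y ≤ (1 - s) * (Lam * k y) at hau
  refine (mul_le_mul_of_nonneg_right (hbound y) ha0).trans ?_
  have t1 : (Metric.ball (0 : RSpace n) r).indicator (fun y => C * ‖y‖ ^ 2) y * a y ≤
      (1 - s) * ((C * Lam) *
        (Metric.ball (0 : RSpace n) r).indicator (fun y => ‖y‖ ^ 2 * k y) y) := by
    by_cases hy' : y ∈ Metric.ball (0 : RSpace n) r
    · rw [indicator_of_mem hy', indicator_of_mem hy']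
      nlinarith [mul_le_mul_of_nonneg_left hau (show 0 ≤ C * ‖y‖ ^ 2 by positivity)]
    · simp [indicator_of_notMem hy']
  have t2 : {y : RSpace n | r / 2 ≤ ‖y‖}.indicator (fun _ => ε) y * a y ≤
      (1 - s) * ((ε * Lam) * {y : RSpace n | r / 2 ≤ ‖y‖}.indicator k y) := by
    by_cases hy' : y ∈ {y : RSpace n | r / 2 ≤ ‖y‖}
    · rw [indicator_of_mem hy', indicator_of_mem hy']
      nlinarith [mul_le_mul_of_nonneg_left hau hε.le]
    · simp [indicator_of_notMem hy']
  have t3 : (1 - s) * ((c * lam) * {y : RSpace n | R ≤ ‖y‖}.indicator k y) ≤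
      {y : RSpace n | R ≤ ‖y‖}.indicator (fun _ => c) y * a y := by
    by_cases hy' : y ∈ {y : RSpace n | R ≤ ‖y‖}
    · rw [indicator_of_mem hy', indicator_of_mem hy']
      nlinarith [mul_le_mul_of_nonneg_left hal hc.le]
    · simp [indicator_of_notMem hy']
  rw [hh]
  linarith

/-! ### Localized test functions -/

/-- The function that is `p` near `x₀` and `g` away from `x₀`, glued by the bump function `χ`. -/
noncomputable def glue {n : ℕ} (χ : ContDiffBump (0 : RSpace n)) (x₀ : RSpace n) (p g : RSpace n → ℝ)
    (x : RSpace n) : ℝ :=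
  χ (x - x₀) * p x + (1 - χ (x - x₀)) * g x

theorem glue_self {n : ℕ} (χ : ContDiffBump (0 : RSpace n)) (x₀ : RSpace n)
    (p g : RSpace n → ℝ) : glue χ x₀ p g x₀ = p x₀ := by
  simp [glue, χ.one_of_mem_closedBall (Metric.mem_closedBall_self χ.rIn_pos.le)]

theorem contDiff_glue {n : ℕ} (χ : ContDiffBump (0 : RSpace n)) (x₀ : RSpace n)
    {p g : RSpace n → ℝ} (hp : ContDiff ℝ 2 p) (hg : ContDiff ℝ 2 g) :
    ContDiff ℝ 2 (glue χ x₀ p g) := by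
  have h : ContDiff ℝ 2 fun x => χ (x - x₀) := χ.contDiff.comp (contDiff_id.sub contDiff_const)
  exact (h.mul hp).add ((contDiff_const.sub h).mul hg)

theorem isBddFun_glue {n : ℕ} (χ : ContDiffBump (0 : RSpace n)) (x₀ : RSpace n)
    {p g : RSpace n → ℝ} (hp : Continuous p) (hg : IsBddFun g) : IsBddFun (glue χ x₀ p g) := by
  obtain ⟨M, hM⟩ := hg
  have hc : Continuous fun x => χ (x - x₀) * p x :=
    (χ.continuous.comp (by fun_prop)).mul hp
  have hs : HasCompactSupport fun x => χ (x - x₀) * p x :=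
    (χ.hasCompactSupport.comp_homeomorph (Homeomorph.subRight x₀)).mul_right
  obtain ⟨A, hA⟩ := hs.exists_bound_of_continuous hc
  refine ⟨A + M, fun x => (abs_add_le _ _).trans (add_le_add (hA x) ?_)⟩
  rw [abs_mul, abs_of_nonneg (sub_nonneg.2 χ.le_one)]
  exact (mul_le_of_le_one_left (abs_nonneg _) (by linarith [χ.nonneg (x := x - x₀)])).trans (hM x)

theorem le_glue {n : ℕ} (χ : ContDiffBump (0 : RSpace n)) (x₀ : RSpace n)
    {u p g : RSpace n → ℝ} {x : RSpace n} (hp : u x ≤ p x) (hg : u x ≤ g x) :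
    u x ≤ glue χ x₀ p g x := by
  have h0 : 0 ≤ χ (x - x₀) := χ.nonneg
  have h1 : χ (x - x₀) ≤ 1 := χ.le_one
  unfold glue
  nlinarith

theorem glue_le {n : ℕ} (χ : ContDiffBump (0 : RSpace n)) (x₀ : RSpace n)
    {u p g : RSpace n → ℝ} {x : RSpace n} (hp : p x ≤ u x) (hg : g x ≤ u x) :
    glue χ x₀ p g x ≤ u x := by
  have h0 : 0 ≤ χ (x - x₀) := χ.nonneg
  have h1 : χ (x - x₀) ≤ 1 := χ.le_one
  unfold glue
  nlinarith

theorem exists_contDiff_approx_above_below {n : ℕ} {u : RSpace n → ℝ} (hu : Continuous u)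
    (hub : IsBddFun u) {ε : ℝ} (hε : 0 < ε) :
    ∃ g₁ g₂ : RSpace n → ℝ, ContDiff ℝ 2 g₁ ∧ ContDiff ℝ 2 g₂ ∧ IsBddFun g₁ ∧ IsBddFun g₂ ∧
      (∀ x, u x ≤ g₁ x ∧ g₁ x ≤ u x + ε) ∧ ∀ x, u x - ε ≤ g₂ x ∧ g₂ x ≤ u x := by
  obtain ⟨g, hg, hgu, -⟩ := hu.exists_contDiff_approx (ε := fun _ => ε / 2) 2 continuous_const
    (fun _ => half_pos hε)
  obtain ⟨M, hM⟩ := hub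
  have h : ∀ x, u x - ε / 2 < g x ∧ g x < u x + ε / 2 := fun x => by
    have := abs_lt.1 (hgu x)
    constructor <;> linarith [this.1, this.2]
  have h' : ∀ x, -M ≤ u x ∧ u x ≤ M := fun x => abs_le.1 (hM x)
  have hg : ContDiff ℝ 2 g := hg
  refine ⟨fun x => g x + ε / 2, fun x => g x - ε / 2, hg.add contDiff_const,
    hg.sub contDiff_const, ⟨M + ε, fun x => ?_⟩, ⟨M + ε, fun x => ?_⟩, fun x => ?_, fun x => ?_⟩
  · rw [abs_le]
    constructor <;> linarith [(h x).1, (h x).2, (h' x).1, (h' x).2]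
  · rw [abs_le]
    constructor <;> linarith [(h x).1, (h x).2, (h' x).1, (h' x).2]
  · constructor <;> linarith [(h x).1, (h x).2]
  · constructor <;> linarith [(h x).1, (h x).2]

/-- Test functions must be bounded, which `θ` need not be. Only contact at `x₀` matters here: the
obstacle inequalities do not involve the value of `I` on the test function. -/
theorem exists_bounded_test_above {n : ℕ} {u p : RSpace n → ℝ} (hu : Continuous u)
    (hub : IsBddFun u) (hp : ContDiff ℝ 2 p) {x₀ : RSpace n}
    (hmax : ∀ x, u x - p x ≤ u x₀ - p x₀) :
    ∃ ψ, IsBddFun ψ ∧ ContDiff ℝ 2 ψ ∧ ∀ x, u x - ψ x ≤ u x₀ - ψ x₀ := by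
  obtain ⟨g, -, hg, -, hgb, -, hug, -⟩ := exists_contDiff_approx_above_below hu hub one_pos
  let χ : ContDiffBump (0 : RSpace n) := ⟨1, 2, one_pos, one_lt_two⟩
  have hq : ContDiff ℝ 2 fun x => p x + (u x₀ - p x₀) := hp.add contDiff_const
  refine ⟨glue χ x₀ (fun x => p x + (u x₀ - p x₀)) g, isBddFun_glue χ x₀ hq.continuous hgb,
    contDiff_glue χ x₀ hq hg, fun x => ?_⟩
  have := le_glue χ x₀ (u := u) (p := fun x => p x + (u x₀ - p x₀)) (g := g) (x := x)
    (by linarith [hmax x]) (hug x).1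
  rw [glue_self]
  linarith

theorem exists_bounded_test_below {n : ℕ} {u p : RSpace n → ℝ} (hu : Continuous u)
    (hub : IsBddFun u) (hp : ContDiff ℝ 2 p) {x₀ : RSpace n}
    (hmin : ∀ x, u x₀ - p x₀ ≤ u x - p x) :
    ∃ ψ, IsBddFun ψ ∧ ContDiff ℝ 2 ψ ∧ ∀ x, u x₀ - ψ x₀ ≤ u x - ψ x := by
  obtain ⟨M, hM⟩ := hub
  obtain ⟨ψ, ⟨A, hA⟩, hψ, h⟩ := exists_bounded_test_above (u := -u) (p := -p) hu.neg
    ⟨M, fun x => by simpa using hM x⟩ hp.neg (x₀ := x₀)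
    (fun x => by simp only [Pi.neg_apply]; linarith [hmin x])
  refine ⟨-ψ, ⟨A, fun x => by simpa using hA x⟩, hψ.neg, fun x => ?_⟩
  have := h x
  simp only [Pi.neg_apply] at this ⊢
  linarith

/-! ### Comparison at a maximum of the doubled function -/

/-- The maximum in each variable gives a smooth contact function built from `θ`. It is kept only
near the contact point and glued to a close approximation of `u`, so that the nonlocal operator
still sees the far deficit of `u`. -/
theorem doubled_max_comparison {n : ℕ} [NeZero n] {s lam Lam : ℝ} (hs0 : 0 < s) (hs1 : s < 1)
    (hlam : 0 < lam) (hLam : lam ≤ Lam) {I : (RSpace n → ℝ) → RSpace n → ℝ}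
    (hI_ell : IsUniformlyElliptic (kernelClassL0 n s lam Lam) I)
    (hI_trans : IsTranslationInvariant I) {u θ : RSpace n → ℝ} (hu : Continuous u)
    (hub : IsBddFun u) (hθ : ContDiff ℝ 2 θ) {x₀ y₀ : RSpace n}
    (hmax : ∀ x y, u x - u y - θ (x - y) ≤ u x₀ - u y₀ - θ (x₀ - y₀))
    {c R : ℝ} (hc : 0 < c) (hR : 0 < R)
    (hfar : ∀ y, R ≤ ‖y‖ → u (x₀ + y) - u (y₀ + y) ≤ u x₀ - u y₀ - c)
    (hsub : ∀ ψ, IsBddFun ψ → ContDiff ℝ 2 ψ → (∀ x, u x - ψ x ≤ u x₀ - ψ x₀) → 0 ≤ I ψ x₀) :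
    ∃ ψ, IsBddFun ψ ∧ ContDiff ℝ 2 ψ ∧ (∀ x, u y₀ - ψ y₀ ≤ u x - ψ x) ∧ 0 < I ψ y₀ := by
  obtain ⟨C, hC, r₀, hr₀, hθC⟩ := hθ.contDiffAt.exists_secondDiff_bound (x := x₀ - y₀)
  obtain ⟨r, hr, hrr₀, ε, hε, hneg⟩ := exists_extremalSup_neg (n := n) hs0 hs1 hlam hLam
    (C := 2 * C) (c := 2 * c) (R := R) (r₀ := min r₀ R) (by positivity) (by positivity) hR
    (by positivity)
  obtain ⟨g₁, g₂, hg₁, hg₂, hgb₁, hgb₂, hug₁, hug₂⟩ :=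
    exists_contDiff_approx_above_below hu hub (ε := ε / 4) (by positivity)
  let χ : ContDiffBump (0 : RSpace n) := ⟨r / 2, r, half_pos hr, half_lt_self hr⟩
  set p₁ : RSpace n → ℝ := fun x => u x₀ + θ (x - y₀) - θ (x₀ - y₀) with hp₁
  set p₂ : RSpace n → ℝ := fun y => u y₀ - θ (x₀ - y) + θ (x₀ - y₀) with hp₂
  have hp₁d : ContDiff ℝ 2 p₁ := by fun_prop
  have hp₂d : ContDiff ℝ 2 p₂ := by fun_prop
  set ψ₁ := glue χ x₀ p₁ g₁ with hψ₁
  set ψ₂ := glue χ y₀ p₂ g₂ with hψ₂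
  have hψ₁d : ContDiff ℝ 2 ψ₁ := contDiff_glue χ x₀ hp₁d hg₁
  have hψ₂d : ContDiff ℝ 2 ψ₂ := contDiff_glue χ y₀ hp₂d hg₂
  have hψ₁b : IsBddFun ψ₁ := isBddFun_glue χ x₀ hp₁d.continuous hgb₁
  have hψ₂b : IsBddFun ψ₂ := isBddFun_glue χ y₀ hp₂d.continuous hgb₂
  have hψ₁x : ψ₁ x₀ = u x₀ := by rw [hψ₁, glue_self]; simp [hp₁]
  have hψ₂y : ψ₂ y₀ = u y₀ := by rw [hψ₂, glue_self]; simp [hp₂]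
  have h₁ : 0 ≤ I ψ₁ x₀ := by
    refine hsub ψ₁ hψ₁b hψ₁d fun x => ?_
    have := le_glue χ x₀ (u := u) (p := p₁) (g := g₁) (x := x)
      (by simp only [hp₁]; linarith [hmax x y₀]) (hug₁ x).1
    rw [hψ₁x]
    linarith
  refine ⟨ψ₂, hψ₂b, hψ₂d, fun x => ?_, ?_⟩
  · have := glue_le χ y₀ (u := u) (p := p₂) (g := g₂) (x := x)
      (by simp only [hp₂]; linarith [hmax x₀ x]) (hug₂ x).2
    rw [hψ₂y]
    linarith
  -- Translating by `z₀` lets both test functions be compared at the single point `x₀`; the two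
  -- cutoffs then coincide.
  set z₀ := x₀ - y₀ with hz₀
  have hxz : x₀ - z₀ = y₀ := by rw [hz₀, sub_sub_cancel]
  set Ψ : RSpace n → ℝ := fun x => ψ₂ (x - z₀) with hΨ
  have hΨd : ContDiff ℝ 2 Ψ := hψ₂d.comp (contDiff_id.sub contDiff_const)
  have hΨb : IsBddFun Ψ := hψ₂b.imp fun A hA x => hA _
  have htrans : I Ψ x₀ = I ψ₂ y₀ := by
    rw [hΨ, hI_trans ψ₂ z₀ x₀ (hψ₂d.admissible hψ₂b _), hxz]
  have hell := (hI_ell ψ₁ Ψ x₀ (hψ₁d.admissible hψ₁b _) (hΨd.admissible hΨb _)).2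
  have hwb : IsBddFun (ψ₁ - Ψ) := by
    obtain ⟨A, hA⟩ := hψ₁b
    obtain ⟨B, hB⟩ := hΨb
    exact ⟨A + B, fun x => (abs_sub _ _).trans (add_le_add (hA x) (hB x))⟩
  suffices extremalSup (kernelClassL0 n s lam Lam) (ψ₁ - Ψ) x₀ < 0 by
    rw [htrans] at hell
    linarith
  have hw : ∀ y, (ψ₁ - Ψ) (x₀ + y) - (ψ₁ - Ψ) x₀ ≤
      (Metric.ball 0 r).indicator (fun y => C * ‖y‖ ^ 2) y +
        {y | r / 2 ≤ ‖y‖}.indicator (fun _ => ε / 2) y -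
        {y | R ≤ ‖y‖}.indicator (fun _ => c) y := by
    intro y
    have e1 : x₀ + y - z₀ = y₀ + y := by rw [hz₀]; abel
    have e2 : x₀ + y - y₀ = z₀ + y := by rw [hz₀]; abel
    have e3 : x₀ - (y₀ + y) = z₀ - y := by rw [hz₀]; abel
    -- Near the contact points the first-order increment of the difference is already a second
    -- difference of `θ` at `z₀`, because `θ` enters once through `x` and once through `y`.
    have hform : (ψ₁ - Ψ) (x₀ + y) - (ψ₁ - Ψ) x₀ = χ y * secondDiff θ z₀ y +
        (1 - χ y) * (g₁ (x₀ + y) - g₂ (y₀ + y) - (u x₀ - u y₀)) := by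
      simp only [Pi.sub_apply, hΨ, hψ₁x, hxz, hψ₂y]
      simp only [hψ₁, hψ₂, glue, hp₁, hp₂, e1, e2, e3, add_sub_cancel_left, secondDiff]
      ring
    have hT : g₁ (x₀ + y) - g₂ (y₀ + y) ≤ u (x₀ + y) - u (y₀ + y) + ε / 2 := by
      linarith [(hug₁ (x₀ + y)).2, (hug₂ (y₀ + y)).1]
    -- Diagonal shift: `θ (x - y)` takes the same value at both pairs.
    have hT0 : u (x₀ + y) - u (y₀ + y) ≤ u x₀ - u y₀ := by
      have := hmax (x₀ + y) (y₀ + y)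
      rw [add_sub_add_right_eq_sub] at this
      linarith
    have hχ0 : 0 ≤ χ y := χ.nonneg
    have hχ1 : χ y ≤ 1 := χ.le_one
    rw [hform]
    rcases lt_or_ge ‖y‖ r with hyr | hyr
    · have hyr₀ : ‖y‖ < r₀ := hyr.trans (hrr₀.trans_le (min_le_left _ _))
      have hyR : ¬ R ≤ ‖y‖ := not_le.2 (hyr.trans (hrr₀.trans_le (min_le_right _ _)))
      have hS := (abs_le.1 (hθC y hyr₀)).2
      rw [indicator_of_mem (by simpa using hyr), indicator_of_notMem (s := {y | R ≤ ‖y‖}) hyR]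
      rcases lt_or_ge ‖y‖ (r / 2) with hyr2 | hyr2
      · rw [indicator_of_notMem (s := {y | r / 2 ≤ ‖y‖}) (not_le.2 hyr2),
          χ.one_of_mem_closedBall (by simpa using hyr2.le)]
        linarith
      · rw [indicator_of_mem (s := {y | r / 2 ≤ ‖y‖}) hyr2]
        have : 0 ≤ C * ‖y‖ ^ 2 := by positivity
        nlinarith [mul_le_mul_of_nonneg_left hS hχ0, mul_le_mul_of_nonneg_left
          (show g₁ (x₀ + y) - g₂ (y₀ + y) - (u x₀ - u y₀) ≤ ε / 2 by linarith)
          (sub_nonneg.2 hχ1)]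
    · rw [χ.zero_of_le_dist (by simpa using hyr),
        indicator_of_notMem (s := Metric.ball 0 r) (by simpa using hyr),
        indicator_of_mem (s := {y | r / 2 ≤ ‖y‖}) (by simp only [mem_ofPred_eq]; linarith)]
      by_cases hyR : R ≤ ‖y‖
      · rw [indicator_of_mem (s := {y | R ≤ ‖y‖}) hyR]
        linarith [hfar y hyR]
      · rw [indicator_of_notMem (s := {y | R ≤ ‖y‖}) hyR]
        linarith
  -- Adding the increments at `y` and `-y` doubles the constants to `2 * C`, `ε` and `2 * c`.
  refine hneg _ _ (hψ₁d.sub hΨd) hwb fun y => ?_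
  have ha := hw y
  have hb := hw (-y)
  rw [← sub_eq_add_neg] at hb
  rw [secondDiff]
  simp only [indicator, norm_neg, mem_ofPred_eq, mem_ball_zero_iff] at ha hb ⊢
  split_ifs at ha hb ⊢ <;> linarith

/-! ### The obstacles -/

/-- Otherwise the connected segment would be split by `U` and the complement of its closure. -/
theorem exists_mem_frontier_segment {E : Type*} [AddCommGroup E] [Module ℝ E] [TopologicalSpace E]
    [IsTopologicalAddGroup E] [ContinuousSMul ℝ E] {U : Set E} (hU : IsOpen U) {x z : E}
    (hx : x ∈ U) (hz : z ∉ U) :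
    ∃ t : ℝ, 0 ≤ t ∧ t ≤ 1 ∧ z + t • (x - z) ∈ frontier U := by
  by_contra! h
  have hsub : segment ℝ z x ⊆ U ∪ (closure U)ᶜ := by
    rintro _ hy
    rw [segment_eq_image'] at hy
    obtain ⟨t, ⟨ht0, ht1⟩, rfl⟩ := hy
    by_contra hcon
    simp only [mem_union, mem_compl_iff, not_or, not_not] at hcon
    exact h t ht0 ht1 (hU.frontier_eq ▸ ⟨hcon.2, hcon.1⟩)
  have hpre : IsPreconnected (segment ℝ z x) := (convex_segment z x).isPreconnected
  have := hpre.subset_left_of_subset_union hU isClosed_closure.isOpen_compl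
    (disjoint_compl_right.mono_left subset_closure) hsub ⟨x, right_mem_segment ℝ z x, hx⟩
  exact hz (this (left_mem_segment ℝ z x))

section Obstacle

variable {n : ℕ} {K U : Set (RSpace n)} {φ : RSpace n → ℝ}

theorem gauge_sub_le_add (hK : Convex ℝ K) (hK0 : K ∈ nhds 0) (x y z : RSpace n) :
    gauge K (x - z) ≤ gauge K (x - y) + gauge K (y - z) := by
  rw [← sub_add_sub_cancel x y z]
  exact gauge_add_le hK (absorbent_nhds_zero hK0) _ _

theorem rho_le (hφ : IsBddFun φ) {x y : RSpace n} (hx : x ∈ U) (hy : y ∈ frontier U) :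
    rho K U φ x ≤ gauge K (x - y) + φ y := by
  rw [rho, if_pos hx]
  obtain ⟨M, hM⟩ := hφ
  refine csInf_le ⟨-M, ?_⟩ (mem_image_of_mem _ hy)
  rintro _ ⟨z, -, rfl⟩
  have := gauge_nonneg (s := K) (x - z)
  simp only
  linarith [(abs_le.1 (hM z)).1]

theorem le_rho (hne : (frontier U).Nonempty) {x : RSpace n} (hx : x ∈ U) {c : ℝ}
    (h : ∀ y ∈ frontier U, c ≤ gauge K (x - y) + φ y) : c ≤ rho K U φ x := by
  rw [rho, if_pos hx]
  refine le_csInf (hne.image _) ?_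
  rintro _ ⟨z, hz, rfl⟩
  exact h z hz

theorem rho_le_rho_add_gauge (hK : Convex ℝ K) (hK0 : K ∈ nhds 0) (hφ : IsBddFun φ)
    (hne : (frontier U).Nonempty) {x y : RSpace n} (hx : x ∈ U) (hy : y ∈ U) :
    rho K U φ x ≤ rho K U φ y + gauge K (x - y) := by
  rw [← sub_le_iff_le_add]
  refine le_rho hne hy fun z hz => ?_
  linarith [rho_le (K := K) hφ hx hz, gauge_sub_le_add hK hK0 x y z]

/-- The segment from `z` to `x` crosses `∂U`. The gauge is additive along it, so the definition of
`ρ` handles one piece and the bound on `φ` the other. -/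
theorem rho_le_of_notMem (hφ : IsBddFun φ)
    (hlip : ∀ x y, φ x - φ y ≤ gauge K (x - y)) (hU : IsOpen U) {x z : RSpace n} (hx : x ∈ U)
    (hz : z ∉ U) : rho K U φ x ≤ φ z + gauge K (x - z) := by
  obtain ⟨t, ht0, ht1, hy⟩ := exists_mem_frontier_segment hU hx hz
  set y := z + t • (x - z) with hydef
  have e1 : x - y = (1 - t) • (x - z) := by rw [hydef]; module
  have e2 : y - z = t • (x - z) := by rw [hydef]; module
  have h1 := rho_le (K := K) hφ hx hy
  have h2 := hlip y z
  rw [e1, gauge_smul_of_nonneg (sub_nonneg.2 ht1), smul_eq_mul] at h1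
  rw [e2, gauge_smul_of_nonneg ht0, smul_eq_mul] at h2
  linarith

/-- This symmetry transfers the estimates for `ρ` to `ρ̄`. -/
theorem rhoBar_eq_rho_neg (x : RSpace n) : rhoBar K U φ x = rho (-K) U (-φ) x := by
  have : ∀ y, gauge (-K) (x - y) = gauge K (y - x) := fun y => by
    rw [← neg_sub y x, gauge_neg_set_neg]
  simp only [rhoBar, rho, this, Pi.neg_apply, ← sub_eq_add_neg]

theorem neg_rhoBar_le_rho (hK : Convex ℝ K) (hK0 : K ∈ nhds 0)
    (hlip : ∀ x y, φ x - φ y ≤ gauge K (x - y)) (hne : (frontier U).Nonempty) {x : RSpace n}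
    (hx : x ∈ U) : -rhoBar K U φ x ≤ rho K U φ x := by
  refine le_rho hne hx fun y hy => ?_
  rw [neg_le, rhoBar_eq_rho_neg]
  refine le_rho hne hx fun y' hy' => ?_
  rw [← neg_sub y' x, gauge_neg_set_neg, Pi.neg_apply]
  linarith [hlip y' y, gauge_sub_le_add hK hK0 y' x y]

theorem IsBddFun.neg (hφ : IsBddFun φ) : IsBddFun (-φ) :=
  hφ.imp fun _ hM x => by simpa using hM x

theorem rhoBar_le_rhoBar_add_gauge (hK : Convex ℝ K) (hK0 : K ∈ nhds 0) (hφ : IsBddFun φ)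
    (hne : (frontier U).Nonempty) {x y : RSpace n} (hx : x ∈ U) (hy : y ∈ U) :
    rhoBar K U φ x ≤ rhoBar K U φ y + gauge K (y - x) := by
  rw [rhoBar_eq_rho_neg, rhoBar_eq_rho_neg, ← gauge_neg_set_neg, neg_sub]
  exact rho_le_rho_add_gauge hK.neg (by simpa using neg_mem_nhds_zero _ hK0) hφ.neg hne hx hy

theorem rhoBar_le_of_notMem (hφ : IsBddFun φ)
    (hlip : ∀ x y, φ x - φ y ≤ gauge K (x - y)) (hU : IsOpen U) {x z : RSpace n} (hx : x ∈ U)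
    (hz : z ∉ U) : rhoBar K U φ x ≤ -φ z + gauge K (z - x) := by
  rw [rhoBar_eq_rho_neg, ← gauge_neg_set_neg, neg_sub]
  refine rho_le_of_notMem hφ.neg (fun a b => ?_) hU hx hz
  rw [← neg_sub b a, gauge_neg_set_neg, Pi.neg_apply, Pi.neg_apply]
  linarith [hlip b a]

/-! ### The gradient bound in integrated form -/

theorem SolvesDoubleObstacle.isBddFun {I : (RSpace n → ℝ) → RSpace n → ℝ} {u : RSpace n → ℝ}
    (hu : SolvesDoubleObstacle I K U φ u) (hU : Bornology.IsBounded U) (hφ : IsBddFun φ) :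
    IsBddFun u := by
  obtain ⟨M, hM⟩ := hφ
  obtain ⟨A, hA⟩ := hU.isCompact_closure.exists_bound_of_continuousOn hu.1.1.continuousOn
  refine ⟨max M A, fun x => ?_⟩
  by_cases hx : x ∈ U
  · exact (hA x (subset_closure hx)).trans (le_max_right _ _)
  · rw [hu.2 x hx]
    exact (hM x).trans (le_max_left _ _)

/-- Outside a compact set of pairs the function is at most `ε`, hence at most its value at `(a, b)`.
Either both points are outside `U`, or one is in the bounded set `U` and they are so far apart that
the gauge exceeds the oscillation `2 * M` of `u`. -/
theorem exists_doubled_max {u θ : RSpace n → ℝ} (hu : Continuous u) (hub : IsBddFun u)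
    (hU : Bornology.IsBounded U) (hK : IsCompact K) (hK0 : K ∈ nhds 0) {ε : ℝ}
    (hθ : Continuous θ) (hθK : ∀ x, gauge K x - ε ≤ θ x)
    (hout : ∀ x y, x ∉ U → y ∉ U → u x - u y - θ (x - y) ≤ ε) {a b : RSpace n}
    (hab : ε ≤ u a - u b - θ (a - b)) :
    ∃ x₀ y₀, ∀ x y, u x - u y - θ (x - y) ≤ u x₀ - u y₀ - θ (x₀ - y₀) := by
  obtain ⟨M, hM⟩ := hub
  obtain ⟨R, hR⟩ := hU.subset_closedBall 0
  obtain ⟨κ, hκ0, hκ⟩ := hK.isBounded.subset_closedBall_lt 0 0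
  have hM0 : 0 ≤ M := (abs_nonneg _).trans (hM 0)
  have hfar : ∀ x y, 2 * M * κ ≤ ‖x - y‖ → u x - u y - θ (x - y) ≤ ε := by
    intro x y hxy
    have h1 := le_gauge_of_subset_closedBall (x := x - y) (absorbent_nhds_zero hK0) hκ0.le hκ
    have h2 : 2 * M ≤ ‖x - y‖ / κ := (le_div_iff₀ hκ0).2 hxy
    linarith [hθK (x - y), (abs_le.1 (hM x)).2, (abs_le.1 (hM y)).1]
  have hcont : Continuous fun q : RSpace n × RSpace n => u q.1 - u q.2 - θ (q.1 - q.2) := by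
    fun_prop
  obtain ⟨q, hq⟩ := hcont.exists_forall_ge' (a, b) (by
    refine Filter.mem_cocompact.2 ⟨Metric.closedBall 0 (R + 2 * M * κ),
      isCompact_closedBall _ _, fun q hq => le_trans ?_ hab⟩
    simp only [mem_compl_iff, mem_closedBall_zero_iff, not_le, Prod.norm_def, lt_max_iff] at hq
    have hD : 0 ≤ 2 * M * κ := by positivity
    have hmem : ∀ x ∈ U, ‖x‖ ≤ R := fun x hx => by simpa using hR hx
    by_cases h1 : q.1 ∈ U
    · have := hmem _ h1
      have := norm_sub_norm_le q.2 q.1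
      rw [norm_sub_rev] at this
      rcases hq with hq | hq <;> exact hfar _ _ (by linarith)
    by_cases h2 : q.2 ∈ U
    · have := hmem _ h2
      have := norm_sub_norm_le q.1 q.2
      rcases hq with hq | hq <;> exact hfar _ _ (by linarith)
    exact hout _ _ h1 h2)
  exact ⟨q.1, q.2, fun x y => hq (x, y)⟩

theorem SolvesDoubleObstacle.sub_le_gauge [NeZero n] {s lam Lam : ℝ} (hs0 : 0 < s) (hs1 : s < 1)
    (hlam : 0 < lam) (hLam : lam ≤ Lam) {I : (RSpace n → ℝ) → RSpace n → ℝ}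
    (hI_ell : IsUniformlyElliptic (kernelClassL0 n s lam Lam) I)
    (hI_trans : IsTranslationInvariant I) (hU_open : IsOpen U) (hU : Bornology.IsBounded U)
    (hK_compact : IsCompact K) (hK : Convex ℝ K) (hK0 : K ∈ nhds 0) (hφ : IsBddFun φ)
    (hlip : ∀ x y, φ x - φ y ≤ gauge K (x - y)) {u : RSpace n → ℝ}
    (hu : SolvesDoubleObstacle I K U φ u) (x y : RSpace n) : u x - u y ≤ gauge K (x - y) := by
  rcases U.eq_empty_or_nonempty with rfl | hUne
  · rw [hu.2 x (notMem_empty x), hu.2 y (notMem_empty y)]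
    exact hlip x y
  have hne : (frontier U).Nonempty := by
    refine nonempty_frontier_iff.2 ⟨hUne, ?_⟩
    rintro rfl
    exact NormedSpace.unbounded_univ ℝ (RSpace n) hU
  by_contra! hlt
  set m := u x - u y - gauge K (x - y) with hm
  have hm0 : 0 < m := by linarith
  have hub := hu.isBddFun hU hφ
  obtain ⟨⟨hcont, hsub, hsup⟩, hbdry⟩ := hu
  obtain ⟨θ, hθ, hθK, -⟩ := (continuous_gauge hK hK0).exists_contDiff_approx
    (ε := fun _ => m / 4) 2 continuous_const (fun _ => by positivity)
  have hθ : ContDiff ℝ 2 θ := hθ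
  have hθK : ∀ z, gauge K z - m / 4 ≤ θ z ∧ θ z ≤ gauge K z + m / 4 := fun z => by
    have := abs_lt.1 (hθK z)
    constructor <;> linarith [this.1, this.2]
  obtain ⟨x₀, y₀, hmax⟩ := exists_doubled_max (ε := m / 4) (a := x) (b := y) hcont hub hU
    hK_compact hK0 hθ.continuous (fun z => (hθK z).1)
    (fun a b ha hb => by
      rw [hbdry a ha, hbdry b hb]
      linarith [hlip a b, (hθK (a - b)).1])
    (by linarith [(hθK (x - y)).2])
  -- The value at `(x, y)` is at least `3 * m / 4`, and passing from `θ` back to the gauge at the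
  -- maximum costs another `m / 4`.
  have hgap : gauge K (x₀ - y₀) + m / 2 ≤ u x₀ - u y₀ := by
    linarith [hmax x y, (hθK (x - y)).2, (hθK (x₀ - y₀)).1]
  have hx₀le : x₀ ∈ U → u x₀ ≤ rho K U φ x₀ := by
    intro hx₀
    obtain ⟨ψ, hψb, hψ, hψmax⟩ := exists_bounded_test_above (p := fun x => θ (x - y₀)) hcont hub
      (by fun_prop) (x₀ := x₀) (fun a => by linarith [hmax a y₀])
    have := hsub.2 ψ x₀ hψb hψ hx₀ hψmax
    simp only [doubleObstacleExpr, max_le_iff] at this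
    linarith [this.2]
  have hy₀le : y₀ ∈ U → -rhoBar K U φ y₀ ≤ u y₀ := by
    intro hy₀
    obtain ⟨ψ, hψb, hψ, hψmin⟩ := exists_bounded_test_below (p := fun y => -θ (x₀ - y)) hcont hub
      (by fun_prop) (x₀ := y₀) (fun a => by linarith [hmax x₀ a])
    have := hsup.2 ψ y₀ hψb hψ hy₀ hψmin
    simp only [doubleObstacleExpr, le_max_iff, le_min_iff] at this
    rcases this with h | h
    · linarith [h.2]
    -- In this branch `u` lies on or above the upper obstacle, which dominates the lower one.
    · linarith [neg_rhoBar_le_rho hK hK0 hlip hne hy₀]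
  have hx₀ : x₀ ∈ U := by
    by_contra hx₀
    have h1 := hbdry x₀ hx₀
    by_cases hy₀ : y₀ ∈ U
    · linarith [rhoBar_le_of_notMem hφ hlip hU_open hy₀ hx₀, hy₀le hy₀]
    · linarith [hbdry y₀ hy₀, hlip x₀ y₀]
  have hy₀ : y₀ ∈ U := by
    by_contra hy₀
    linarith [hbdry y₀ hy₀, rho_le_of_notMem hφ hlip hU_open hx₀ hy₀, hx₀le hx₀]
  -- Going from `y₀` to `x₀`, `-ρ̄` rises by at most the gauge while `u` rises by `m / 2` more, so
  -- the lower obstacle is inactive at `x₀`; symmetrically for `ρ` at `y₀`.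
  have hx₀bar : 0 < u x₀ + rhoBar K U φ x₀ := by
    linarith [hy₀le hy₀, rhoBar_le_rhoBar_add_gauge hK hK0 hφ hne hy₀ hx₀]
  have hy₀rho : u y₀ - rho K U φ y₀ < 0 := by
    linarith [hx₀le hx₀, rho_le_rho_add_gauge hK hK0 hφ hne hx₀ hy₀]
  obtain ⟨R, hRpos, hR⟩ := hU.subset_closedBall_lt 0 0
  -- Any shift longer than the diameter bound `2 * R` leaves `U`.
  have hleave : ∀ z ∈ U, ∀ v : RSpace n, 3 * R ≤ ‖v‖ → z + v ∉ U := by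
    intro z hz v hv hzv
    have h1 : ‖z‖ ≤ R := by simpa using hR hz
    have h2 : ‖z + v‖ ≤ R := by simpa using hR hzv
    have h3 := norm_sub_le (z + v) z
    rw [add_sub_cancel_left] at h3
    linarith
  obtain ⟨ψ, hψb, hψ, hψmin, hψI⟩ := doubled_max_comparison hs0 hs1 hlam hLam hI_ell hI_trans
    hcont hub hθ hmax (c := m / 2) (R := 3 * R) (by positivity) (by positivity)
    (fun v hv => by
      rw [hbdry _ (hleave x₀ hx₀ v hv), hbdry _ (hleave y₀ hy₀ v hv)]
      have := hlip (x₀ + v) (y₀ + v)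
      rw [add_sub_add_right_eq_sub] at this
      linarith)
    (fun ψ hψb hψ hψmax => by
      have := hsub.2 ψ x₀ hψb hψ hx₀ hψmax
      simp only [doubleObstacleExpr, max_le_iff, min_le_iff] at this
      rcases this.1 with h | h <;> linarith)
  have := hsup.2 ψ y₀ hψb hψ hy₀ hψmin
  simp only [doubleObstacleExpr, le_max_iff, le_min_iff] at this
  rcases this with h | h <;> linarith [h]

end Obstacle

/-! ### From the integrated bound to the gradient and the Lipschitz constant -/

theorem gauge_polarSet_gradient_le_one {n : ℕ} {K : Set (RSpace n)} {u : RSpace n → ℝ}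
    {x : RSpace n} (hd : DifferentiableAt ℝ u x)
    (h : ∀ x y, u x - u y ≤ gauge K (x - y)) : gauge (polarSet K) (∇ u x) ≤ 1 := by
  -- It suffices that the gradient lies in the polar: along `y ∈ K` the right difference quotients
  -- of `u` are at most `gauge K y ≤ 1`.
  refine gauge_le_one_of_mem fun y hy => ?_
  rw [inner_gradient_left]
  have hline : HasDerivAt (fun t : ℝ => u (x + t • y)) (fderiv ℝ u x y) 0 :=
    hd.hasFDerivAt.hasLineDerivAt y
  refine le_of_tendsto hline.tendsto_slope_zero_right
    (eventually_mem_nhdsWithin.mono fun t (ht : 0 < t) => ?_)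
  have h1 := h (x + t • y) x
  rw [add_sub_cancel_left, gauge_smul_of_nonneg ht.le, smul_eq_mul] at h1
  have h2 : t * gauge K y ≤ t * 1 := mul_le_mul_of_nonneg_left (gauge_le_one_of_mem hy) ht.le
  simp only [zero_add, zero_smul, add_zero, smul_eq_mul]
  rw [inv_mul_le_iff₀ ht]
  linarith

theorem exists_lipschitzWith_of_sub_le_gauge {n : ℕ} {K : Set (RSpace n)} (hK : Convex ℝ K)
    (hK0 : K ∈ nhds 0) {u : RSpace n → ℝ} (h : ∀ x y, u x - u y ≤ gauge K (x - y)) :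
    ∃ C : ℝ≥0, LipschitzWith C u := by
  obtain ⟨C, hC⟩ := hK.lipschitz_gauge hK0
  refine ⟨C, LipschitzWith.of_le_add_mul C fun x y => ?_⟩
  have := hC.dist_le_mul (x - y) 0
  rw [gauge_zero, Real.dist_eq, sub_zero, dist_zero_right] at this
  rw [dist_eq_norm]
  linarith [h x y, le_abs_self (gauge K (x - y))]

theorem mainTheorem4 {n : ℕ} (s lam Lam : ℝ) (hs0 : 0 < s) (hs1 : s < 1)
    (hlam : 0 < lam) (hLam : lam ≤ Lam)
    (I : (RSpace n → ℝ) → RSpace n → ℝ)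
    (hI : IsNonlocalOperator I)
    (hI_ell : IsUniformlyElliptic (kernelClassL0 n s lam Lam) I)
    (hI_trans : IsTranslationInvariant I)
    (hI_zero : ∀ x, I (fun _ => 0) x = 0)
    (U K : Set (RSpace n)) (φ : RSpace n → ℝ)
    (hU_open : IsOpen U) (hU_bdd : Bornology.IsBounded U)
    (hK_compact : IsCompact K) (hK_convex : Convex ℝ K) (hK_zero : (0 : RSpace n) ∈ interior K)
    (hφ_bdd : IsBddFun φ)
    (hφ_lip : ∀ x y, -gauge K (y - x) ≤ φ x - φ y ∧ φ x - φ y ≤ gauge K (x - y))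
    (hφ_convex : ConvexNear φ (frontier U))
    (u : RSpace n → ℝ) (hu_C1 : ContDiffOn ℝ 1 u U)
    (hu : SolvesDoubleObstacle I K U φ u) :
    (∀ x ∈ U, gauge (polarSet K) (∇ u x) ≤ 1) ∧
      ∃ C : ℝ≥0, LipschitzOnWith C u (closure U) := by
  have hK0 : K ∈ nhds 0 := mem_interior_iff_mem_nhds.1 hK_zero
  have hgauge : ∀ x y, u x - u y ≤ gauge K (x - y) := by
    -- In dimension zero there is no far region to carry the deficit, but the space is a single
    -- point.
    rcases Nat.eq_zero_or_pos n with rfl | hn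
    · intro x y
      rw [Subsingleton.elim x y, sub_self, sub_self, gauge_zero]
    · have : NeZero n := ⟨hn.ne'⟩
      exact hu.sub_le_gauge hs0 hs1 hlam hLam hI_ell hI_trans hU_open hU_bdd hK_compact hK_convex
        hK0 hφ_bdd fun x y => (hφ_lip x y).2
  refine ⟨fun x hx => gauge_polarSet_gradient_le_one
    ((hu_C1.contDiffAt (hU_open.mem_nhds hx)).differentiableAt (by simp)) hgauge, ?_⟩
  obtain ⟨C, hC⟩ := exists_lipschitzWith_of_sub_le_gauge hK_convex hK0 hgauge
  exact ⟨C, hC.lipschitzOnWith⟩
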